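/- Let $d \ge 0$ be an integer, let $\mathbb{R}_{>0}=(0,\infty)$, let $\|\cdot\|$ be the Euclidean norm on $\mathbb{R}^d$, and let $\tau\odot\gamma$ denote the entrywise product of $\tau,\gamma\in\mathbb{R}^d$. A function $h:\mathbb{R}^d\to\mathbb{R}$ is called positive semi-definite if $(x,y)\mapsto h(x-y)$ is symmetric and $\sum_{i,j} c_i c_j h(x_i-x_j)\ge 0$ for all finite families $x_i\in\mathbb{R}^d$, $c_i\in\mathbb{R}$. A stationary real-valued kernel is a continuous positive semi-definite function $k:\mathbb{R}^d\to\mathbb{R}$ (of the lag $\tau=x-y$). A set $G$ of real functions on $\mathbb{R}^d$ is called dense in the stationary kernels if for every stationary real-valued kernel $k$ there is a sequence $g_n\in G$ with $g_n(\tau)\to k(\tau)$ for every $\tau\in\mathbb{R}^d$. For $h:\mathbb{R}^d\to\mathbb{R}$, $A\subseteq\mathbb{R}$ and $\Omega\subseteq\mathbb{R}^d$ let $\mathcal{S}(h;A,\Omega)$ be the set of all functions $$\tau\mapsto\sum_{k=1}^{K}\alpha_k\,h(\tau\odot\gamma_k)\cos(2\pi\,\omega_k^T\tau),\qquad K\ge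 1,\ \alpha_k\in A,\ \omega_k\in\Omega,\ \gamma_k\in\mathbb{R}_{>0}^d .$$ (i) If $h:\mathbb{R}^d\to\mathbb{R}$ is positive semi-definite, continuous, Lebesgue integrable, and $h(\tau)>0$ for all $\tau\in\mathbb{R}^d$, then $\mathcal{S}(h;\mathbb{R},\mathbb{R}_{>0}^d)$ is dense in the stationary kernels. (ii) Let $h$ be the Gaussian $h(\tau)=\exp(-2\pi^2\|\tau\|^2)$ (spectral mixture kernels), or, for some $\nu>0$, the Matérn kernel $$h(\tau)=\frac{1}{\Gamma(\nu)2^{\nu-1}}\left(\sqrt{2\nu}\,\|\tau\|\right)^{\nu}K_\nu\!\left(\sqrt{2\nu}\,\|\tau\|\right)\quad(\tau\ne 0),\qquad h(0)=1$$ (Matérn spectral kernels), where $K_\nu(x)=\int_0^\infty e^{-x\cosh t}\cosh(\nu t)\,dt$ is the modified Bessel function of the second kind. Then $\mathcal{S}(h;\mathbb{R},\mathbb{R}_{>0}^d)$ is dense in the stationary kernels; with positive coefficients, $\mathcal{S}(h;\mathbb{R}_{>0},\mathbb{R}^d)$ is dense in the stationary kernels; and if $d=1$, then also $\mathcal{S}(h;\mathbb{R}_{>0},\mathbb{R}_{>0})$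 is dense in the stationary kernels. -/

import Mathlib

noncomputable section

namespace SpectralKernels

/-- A real function `h` on `ℝ^d` is positive semi-definite if `(x, y) ↦ h (x - y)` is a symmetric
positive semi-definite kernel: for finitely supported real `c`,
`∑ x, ∑ y, c x * h (x - y) * c y ≥ 0`. -/
def IsPosSemidefFun {d : ℕ} (h : EuclideanSpace ℝ (Fin d) → ℝ) : Prop :=
  (Matrix.of fun x y : EuclideanSpace ℝ (Fin d) => h (x - y)).PosSemidef

/-- A stationary real-valued kernel, as a function of the lag `τ = x - y`: the covariance function
of a weakly stationary, mean square continuous real process. -/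
structure IsStationaryKernel {d : ℕ} (k : EuclideanSpace ℝ (Fin d) → ℝ) : Prop where
  continuous : Continuous k
  posSemidef : IsPosSemidefFun k

/-- The entrywise product of two vectors. -/
def hadamard {d : ℕ} (τ γ : EuclideanSpace ℝ (Fin d)) : EuclideanSpace ℝ (Fin d) :=
  WithLp.toLp 2 fun i => τ i * γ i

/-- The open positive orthant. -/
def posOrthant (d : ℕ) : Set (EuclideanSpace ℝ (Fin d)) :=
  {v | ∀ i, 0 < v i}

/-- The functions `τ ↦ ∑ k < K, α k * h (τ ⊙ γ k) * cos (2π ⟨ω k, τ⟩)` with `K ≥ 1`, coefficients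
`α k` in `A`, frequencies `ω k` in `Ω` and inverse scales `γ k` in the positive orthant. -/
def spectralFamily {d : ℕ} (A : Set ℝ) (Ω : Set (EuclideanSpace ℝ (Fin d)))
    (h : EuclideanSpace ℝ (Fin d) → ℝ) : Set (EuclideanSpace ℝ (Fin d) → ℝ) :=
  {g | ∃ (K : ℕ) (α : Fin K → ℝ) (ω γ : Fin K → EuclideanSpace ℝ (Fin d)),
    1 ≤ K ∧ (∀ k, α k ∈ A) ∧ (∀ k, ω k ∈ Ω) ∧ (∀ k, γ k ∈ posOrthant d) ∧
    ∀ τ, g τ = ∑ k, α k * h (hadamard τ (γ k)) * Real.cos (2 * Real.pi * inner ℝ (ω k) τ)}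

/-- `G` is dense in the stationary real-valued kernels for pointwise convergence: each of these
kernels is the pointwise limit of a sequence of elements of `G`. -/
def DenseInStationaryKernels {d : ℕ} (G : Set (EuclideanSpace ℝ (Fin d) → ℝ)) : Prop :=
  ∀ k : EuclideanSpace ℝ (Fin d) → ℝ, IsStationaryKernel k →
    ∃ g : ℕ → EuclideanSpace ℝ (Fin d) → ℝ, (∀ n, g n ∈ G) ∧
      ∀ τ, Filter.Tendsto (fun n => g n τ) Filter.atTop (nhds (k τ))

/-- The Gaussian kernel that generates the spectral mixture kernels. -/
def gaussianKernel (d : ℕ) (τ : EuclideanSpace ℝ (Fin d)) : ℝ :=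
  Real.exp (-2 * Real.pi ^ 2 * ‖τ‖ ^ 2)

/-- The modified Bessel function of the second kind `K_ν` at `x > 0`. -/
def besselK (ν x : ℝ) : ℝ :=
  ∫ t in Set.Ioi (0 : ℝ), Real.exp (-x * Real.cosh t) * Real.cosh (ν * t)

/-- The Matérn kernel of smoothness `ν > 0`. At `τ = 0`, where `K_ν` has a pole, the formula is read
as its limit `1`. -/
def maternKernel (d : ℕ) (ν : ℝ) (τ : EuclideanSpace ℝ (Fin d)) : ℝ :=
  if τ = 0 then 1
  else 1 / (Real.Gamma ν * 2 ^ (ν - 1)) * (‖τ‖ * √(2 * ν)) ^ ν * besselK ν (‖τ‖ * √(2 * ν))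

end SpectralKernels

end

noncomputable section

namespace SpectralKernels

open Filter Topology

variable {d : ℕ}

/-! ### Members of the spectral families -/

/-! Modulation costs nothing: if `h` is continuous at the origin and `h 0 > 0`, then `h (c • τ) / h
0` tends to `1` as `c → 0`, so everything reduces to plain cosine sums
(`DenseInStationaryKernels.of_one`).

For these, a discrete Fejér argument takes the place of Bochner's theorem. Restrict `k` to a lattice
of mesh `1 / N` and take Fejér means over a box of side `n`. Positive semi-definiteness makes the
coefficients nonnegative (`fejerCoeff_nonneg`), and orthogonality of finitely many characters
recovers `k` at lattice points up to Fejér weights (`fejerSum_intCast`). Between lattice points,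
Cauchy–Schwarz bounds the oscillation of the sum by its defect at unit steps
(`abs_fejerSum_sub_le`), which vanishes with the mesh since `k` is continuous at `0`.

Positive frequencies come from evenness of the cosine when `d = 1`. In general, real coefficients
permit approximating `1` by polynomials in a character that are divisible by a high power of it,
which shifts every frequency into the orthant (`exists_posCosSpan_approx`). For the Matérn kernel
what remains is continuity at the origin, that is, the asymptotics of `besselK` at `0`. -/

theorem mem_spectralFamily_of_fintype {ι : Type*} [Fintype ι] [Nonempty ι] {A : Set ℝ}
    {Ω : Set (EuclideanSpace ℝ (Fin d))} {h : EuclideanSpace ℝ (Fin d) → ℝ}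
    (α : ι → ℝ) (ω γ : ι → EuclideanSpace ℝ (Fin d)) (hα : ∀ j, α j ∈ A) (hω : ∀ j, ω j ∈ Ω)
    (hγ : ∀ j, γ j ∈ posOrthant d) :
    (fun τ => ∑ j, α j * h (hadamard τ (γ j)) * Real.cos (2 * Real.pi * inner ℝ (ω j) τ)) ∈
      spectralFamily A Ω h := by
  let e := (Fintype.equivFin ι).symm
  refine ⟨Fintype.card ι, α ∘ e, ω ∘ e, γ ∘ e, Fintype.card_pos, fun k => hα _, fun k => hω _,
    fun k => hγ _, fun τ => ?_⟩
  exact (Equiv.sum_comp e fun j =>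
    α j * h (hadamard τ (γ j)) * Real.cos (2 * Real.pi * inner ℝ (ω j) τ)).symm

/-- The vector with all entries equal to `c`. -/
def constVec (d : ℕ) (c : ℝ) : EuclideanSpace ℝ (Fin d) := WithLp.toLp 2 fun _ => c

theorem constVec_mem_posOrthant {c : ℝ} (hc : 0 < c) : constVec d c ∈ posOrthant d := fun _ => hc

theorem hadamard_constVec (τ : EuclideanSpace ℝ (Fin d)) (c : ℝ) :
    hadamard τ (constVec d c) = c • τ := by
  ext i
  simp [hadamard, constVec, mul_comm]

theorem cosSum_mem_spectralFamily_one {ι : Type*} [Fintype ι] [Nonempty ι] {A : Set ℝ}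
    {Ω : Set (EuclideanSpace ℝ (Fin d))}
    (α : ι → ℝ) (ω : ι → EuclideanSpace ℝ (Fin d)) (hα : ∀ j, α j ∈ A) (hω : ∀ j, ω j ∈ Ω) :
    (fun τ => ∑ j, α j * Real.cos (2 * Real.pi * inner ℝ (ω j) τ)) ∈
      spectralFamily A Ω (1 : EuclideanSpace ℝ (Fin d) → ℝ) := by
  simpa using mem_spectralFamily_of_fintype (h := 1) α ω (fun _ => constVec d 1) hα hω
    fun _ => constVec_mem_posOrthant one_pos

/-- Density of plain cosine sums passes to the sums modulated by a function `h` that is continuous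
at the origin, since the inverse scales may tend to zero. -/
theorem DenseInStationaryKernels.of_one {A : Set ℝ} {Ω : Set (EuclideanSpace ℝ (Fin d))}
    {h : EuclideanSpace ℝ (Fin d) → ℝ} (hA : ∀ c : ℝ, 0 < c → ∀ a ∈ A, a / c ∈ A)
    (hc : ContinuousAt h 0) (h0 : 0 < h 0)
    (H : DenseInStationaryKernels (spectralFamily A Ω 1)) :
    DenseInStationaryKernels (spectralFamily A Ω h) := by
  intro k hk
  obtain ⟨g, hg, hlim⟩ := H k hk
  choose K α ω γ hK hα hω hγ hgeq using hg
  let c : ℕ → ℝ := fun n => 1 / ((n : ℝ) + 1)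
  have hcpos : ∀ n, 0 < c n := fun n => by positivity
  refine ⟨fun n τ => ∑ j, α n j / h 0 * h (hadamard τ (constVec d (c n))) *
    Real.cos (2 * Real.pi * inner ℝ (ω n j) τ), fun n => ?_, fun τ => ?_⟩
  · have : Nonempty (Fin (K n)) := ⟨⟨0, hK n⟩⟩
    exact mem_spectralFamily_of_fintype (fun j => α n j / h 0) (ω n) (fun _ => constVec d (c n))
      (fun j => hA _ h0 _ (hα n j)) (hω n) fun _ => constVec_mem_posOrthant (hcpos n)
  · have h1 : Tendsto (fun n => h (c n • τ)) atTop (𝓝 (h 0)) := by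
      refine hc.tendsto.comp ?_
      simpa [c] using (tendsto_one_div_add_atTop_nhds_zero_nat (𝕜 := ℝ)).smul_const τ
    -- All terms share one scale, so the modulation factors out of the sum and no bound on the
    -- coefficients is needed.
    have h2 := (h1.div_const (h 0)).mul (hlim τ)
    rw [div_self h0.ne', one_mul] at h2
    refine h2.congr fun n => ?_
    rw [hgeq, Finset.mul_sum]
    refine Finset.sum_congr rfl fun j _ => ?_
    rw [hadamard_constVec]
    simp
    ring

/-! ### Replacing frequencies by positive ones -/

theorem tendsto_of_abs_sub_le {f g : ℕ → ℝ} {a : ℝ} {e : ℕ → ℝ} (hf : Tendsto f atTop (𝓝 a))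
    (he : Tendsto e atTop (𝓝 0)) (h : ∀ᶠ n in atTop, |g n - f n| ≤ e n) :
    Tendsto g atTop (𝓝 a) := by
  have : Tendsto (fun n => g n - f n) atTop (𝓝 0) := squeeze_zero_norm' h he
  simpa using this.add hf

theorem abs_cos_sub_cos_le (x y : ℝ) : |Real.cos x - Real.cos y| ≤ 2 * |Real.sin ((x - y) / 2)| := by
  rw [Real.cos_sub_cos, abs_mul, abs_mul]
  have := Real.abs_sin_le_one ((x + y) / 2)
  have h2 : |(-2 : ℝ)| = 2 := by norm_num
  rw [h2]
  nlinarith [abs_nonneg (Real.sin ((x - y) / 2))]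

theorem abs_cos_sub_cos_le_abs (x y : ℝ) : |Real.cos x - Real.cos y| ≤ |x - y| := by
  refine (abs_cos_sub_cos_le x y).trans ?_
  have := Real.abs_sin_le_abs (x := (x - y) / 2)
  rw [abs_div, abs_two] at this
  linarith

/-- On the line the cosines are even in the frequency, so positive frequencies suffice. -/
theorem DenseInStationaryKernels.posOrthant_one
    (H : DenseInStationaryKernels
      (spectralFamily (Set.Ioi 0) Set.univ (1 : EuclideanSpace ℝ (Fin 1) → ℝ))) :
    DenseInStationaryKernels
      (spectralFamily (Set.Ioi 0) (posOrthant 1) (1 : EuclideanSpace ℝ (Fin 1) → ℝ)) := by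
  intro k hk
  obtain ⟨g, hg, hlim⟩ := H k hk
  choose K α ω γ hK hα hω hγ hgeq using hg
  let c : ℕ → ℝ := fun n => 1 / ((n : ℝ) + 1)
  have hcpos : ∀ n, 0 < c n := fun n => by positivity
  -- The shift by `c n` covers zero frequencies.
  let ω' : ∀ n, Fin (K n) → EuclideanSpace ℝ (Fin 1) := fun n j => constVec 1 (|ω n j 0| + c n)
  refine ⟨fun n τ => ∑ j, α n j * Real.cos (2 * Real.pi * inner ℝ (ω' n j) τ), fun n => ?_,
    fun τ => ?_⟩
  · have : Nonempty (Fin (K n)) := ⟨⟨0, hK n⟩⟩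
    exact cosSum_mem_spectralFamily_one _ _ (hα n) fun j => constVec_mem_posOrthant
      (add_pos_of_nonneg_of_pos (abs_nonneg _) (hcpos n))
  -- The positive coefficients add up to `g n 0`, which converges and hence keeps the total error
  -- small.
  · have hbd : Tendsto (fun n => g n 0 * (2 * Real.pi * c n * |τ 0|)) atTop (𝓝 0) := by
      have : Tendsto (fun n => (2 * Real.pi * c n * |τ 0|)) atTop (𝓝 (2 * Real.pi * 0 * |τ 0|)) :=
        ((tendsto_one_div_add_atTop_nhds_zero_nat (𝕜 := ℝ)).const_mul _).mul_const _
      simpa using (hlim 0).mul this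
    refine tendsto_of_abs_sub_le (hlim τ) hbd (Eventually.of_forall fun n => ?_)
    rw [hgeq, hgeq, ← Finset.sum_sub_distrib, Finset.sum_mul]
    refine (Finset.abs_sum_le_sum_abs _ _).trans (Finset.sum_le_sum fun j _ => ?_)
    have hαj : 0 < α n j := hα n j
    have e1 : Real.cos (2 * Real.pi * inner ℝ (ω n j) τ) =
        Real.cos (2 * Real.pi * (|ω n j 0| * τ 0)) := by
      have : inner ℝ (ω n j) τ = τ 0 * ω n j 0 := by simp [PiLp.inner_apply]
      rw [this]
      rcases abs_choice (ω n j 0) with h | h <;> rw [h]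
      · ring_nf
      · rw [← Real.cos_neg]; ring_nf
    have e2 : inner ℝ (ω' n j) τ = (|ω n j 0| + c n) * τ 0 := by
      simp [PiLp.inner_apply, ω', constVec, mul_comm]
    simp only [Pi.one_apply, mul_one, inner_zero_right, mul_zero, Real.cos_zero]
    rw [e1, e2, ← mul_sub, abs_mul, abs_of_pos hαj]
    refine mul_le_mul_of_nonneg_left ((abs_cos_sub_cos_le_abs _ _).trans (le_of_eq ?_)) hαj.le
    rw [show 2 * Real.pi * ((|ω n j 0| + c n) * τ 0) - 2 * Real.pi * (|ω n j 0| * τ 0) =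
      (2 * Real.pi * c n) * τ 0 by ring, abs_mul, abs_of_pos (by have := hcpos n; positivity)]

/-- The span of the cosines with frequencies in the positive orthant. -/
def posCosSpan (d : ℕ) : Submodule ℝ (EuclideanSpace ℝ (Fin d) → ℝ) :=
  Submodule.span ℝ
    ((fun ω τ => Real.cos (2 * Real.pi * inner ℝ ω τ)) '' posOrthant d)

theorem mem_spectralFamily_of_mem_posCosSpan {f : EuclideanSpace ℝ (Fin d) → ℝ}
    (hf : f ∈ posCosSpan d) : f ∈ spectralFamily Set.univ (posOrthant d) 1 := by
  obtain ⟨n, a, b, rfl⟩ := Submodule.mem_span_set'.1 hf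
  choose ω hω hωb using fun i => (b i).2
  -- The extra index `none` carries coefficient `0`; it keeps the sum nonempty when `n = 0`.
  have := cosSum_mem_spectralFamily_one (ι := Option (Fin n)) (A := Set.univ) (Ω := posOrthant d)
    (fun o => o.elim 0 a) (fun o => o.elim (constVec d 1) ω) (fun _ => trivial)
    (by rintro (_ | j); exacts [constVec_mem_posOrthant one_pos, hω j])
  convert this using 1
  ext τ
  simp [Finset.sum_apply, ← hωb]

/-- A cosine of arbitrary frequency is, uniformly on balls, a limit of real combinations of cosines
with frequencies in the positive orthant. -/
theorem exists_posCosSpan_approx (ω : EuclideanSpace ℝ (Fin d)) (R : ℝ) {ε : ℝ} (hε : 0 < ε) :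
    ∃ f ∈ posCosSpan d, ∀ τ, ‖τ‖ ≤ R → |f τ - Real.cos (2 * Real.pi * inner ℝ ω τ)| ≤ ε := by
  -- The phase bound `1 / 2` yields `‖1 - z‖ ≤ 1 / 2` for the character `z` of frequency `constVec d
  -- s`, throughout the ball.
  obtain ⟨s, hs, hsR⟩ : ∃ s : ℝ, 0 < s ∧ ∀ τ : EuclideanSpace ℝ (Fin d), ‖τ‖ ≤ R →
      |2 * Real.pi * inner ℝ (constVec d s) τ| ≤ 1 / 2 := by
    have hC : 0 < 2 * (2 * Real.pi * ‖constVec d 1‖ * |R| + 1) := by positivity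
    refine ⟨1 / (2 * (2 * Real.pi * ‖constVec d 1‖ * |R| + 1)), by positivity, fun τ hτ => ?_⟩
    have e : ∀ s : ℝ, constVec d s = s • constVec d 1 := fun s => by ext i; simp [constVec]
    rw [e, inner_smul_left, abs_mul (2 * Real.pi), abs_mul (starRingEnd ℝ _),
      abs_of_pos Real.two_pi_pos]
    have h1 := abs_real_inner_le_norm (constVec d 1) τ
    have h2 : ‖constVec d 1‖ * ‖τ‖ ≤ ‖constVec d 1‖ * |R| :=
      mul_le_mul_of_nonneg_left (hτ.trans (le_abs_self R)) (norm_nonneg _)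
    simp only [conj_trivial, abs_of_pos (one_div_pos.2 hC)]
    rw [one_div_mul_eq_div, mul_div_assoc', div_le_iff₀ hC]
    nlinarith [Real.two_pi_pos]
  obtain ⟨m, hm⟩ : ∃ m : ℕ, ∀ j : ℕ, m ≤ j → ω + (j : ℝ) • constVec d s ∈ posOrthant d := by
    obtain ⟨m, hm⟩ := exists_nat_gt (‖ω‖ / s)
    refine ⟨m, fun j hj i => ?_⟩
    have h1 : ‖ω‖ < j * s := by
      rw [← div_lt_iff₀ hs]; exact hm.trans_le (by exact_mod_cast hj)
    have h2 := (abs_le.1 ((Real.norm_eq_abs _).symm.le.trans (PiLp.norm_apply_le ω i))).1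
    simp only [constVec, PiLp.add_apply, PiLp.smul_apply, smul_eq_mul]
    linarith
  obtain ⟨δ, hδ, hδε⟩ : ∃ δ > 0, ∀ w : ℂ, ‖w‖ < δ → ‖(1 - w) ^ m - 1‖ < ε := by
    have : ContinuousAt (fun w : ℂ => (1 - w) ^ m) 0 := by fun_prop
    obtain ⟨δ, hδ, H⟩ := Metric.continuousAt_iff.1 this ε hε
    exact ⟨δ, hδ, fun w hw => by simpa [dist_eq_norm] using H (x := w) (by simpa using hw)⟩
  obtain ⟨n, hn⟩ := exists_pow_lt_of_lt_one hδ (by norm_num : (1 / 2 : ℝ) < 1)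
  -- `q ^ m` is divisible by `X ^ m`, so only shifts `j ≥ m` occur; yet its value at `z` is near `1`
  -- because `(1 - z) ^ (n + 1)` is small.
  let q : Polynomial ℝ := 1 - (1 - Polynomial.X) ^ (n + 1)
  have hq : Polynomial.X ∣ q := by
    rw [Polynomial.X_dvd_iff, Polynomial.coeff_zero_eq_eval_zero]
    simp [q]
  have hcoeff : ∀ j < m, (q ^ m).coeff j = 0 := Polynomial.X_pow_dvd_iff.1 (pow_dvd_pow_of_dvd hq m)
  refine ⟨∑ j ∈ Finset.range ((q ^ m).natDegree + 1), (q ^ m).coeff j •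
    fun τ => Real.cos (2 * Real.pi * inner ℝ (ω + (j : ℝ) • constVec d s) τ),
    Submodule.sum_mem _ fun j _ => ?_, fun τ hτ => ?_⟩
  · rcases lt_or_ge j m with hj | hj
    · rw [hcoeff j hj, zero_smul]
      exact Submodule.zero_mem _
    · exact Submodule.smul_mem _ _ (Submodule.subset_span ⟨_, hm j hj, rfl⟩)
  · set a : ℝ := 2 * Real.pi * inner ℝ ω τ with ha
    set θ : ℝ := 2 * Real.pi * inner ℝ (constVec d s) τ with hθ
    set z : ℂ := Complex.exp (Complex.I * θ) with hz
    have hcos : ∀ j : ℕ, Real.cos (2 * Real.pi * inner ℝ (ω + (j : ℝ) • constVec d s) τ) =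
        (Complex.exp (Complex.I * a) * z ^ j).re := fun j => by
      rw [hz, ← Complex.exp_nat_mul, ← Complex.exp_add, inner_add_left, inner_smul_left,
        conj_trivial, show Complex.I * a + j * (Complex.I * θ) = ((a + j * θ : ℝ) : ℂ) * Complex.I by
          push_cast; ring, Complex.exp_ofReal_mul_I_re, ha, hθ]
      congr 1
      ring
    have hsum : (∑ j ∈ Finset.range ((q ^ m).natDegree + 1), (q ^ m).coeff j •
        fun τ => Real.cos (2 * Real.pi * inner ℝ (ω + (j : ℝ) • constVec d s) τ)) τ =
        (Complex.exp (Complex.I * a) * Polynomial.aeval z (q ^ m)).re := by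
      rw [Polynomial.aeval_eq_sum_range, Finset.mul_sum, Complex.re_sum, Finset.sum_apply]
      refine Finset.sum_congr rfl fun j _ => ?_
      rw [Pi.smul_apply, hcos, mul_smul_comm, Complex.smul_re]
    have hca : Real.cos a = (Complex.exp (Complex.I * a)).re := by
      rw [mul_comm, Complex.exp_ofReal_mul_I_re]
    rw [hsum, hca, ← Complex.sub_re]
    refine (Complex.abs_re_le_norm _).trans ?_
    rw [show Complex.exp (Complex.I * a) * Polynomial.aeval z (q ^ m) - Complex.exp (Complex.I * a) =
      Complex.exp (Complex.I * a) * ((1 - (1 - z) ^ (n + 1)) ^ m - 1) by simp [q]; ring, norm_mul,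
      mul_comm Complex.I, Complex.norm_exp_ofReal_mul_I, one_mul]
    refine (hδε _ ?_).le
    have h1 : ‖1 - z‖ ≤ 1 / 2 := by
      rw [norm_sub_rev]
      exact Real.norm_exp_I_mul_ofReal_sub_one_le.trans (hsR τ hτ)
    calc ‖(1 - z) ^ (n + 1)‖ ≤ (1 / 2) ^ (n + 1) := by rw [norm_pow]; gcongr
      _ ≤ (1 / 2) ^ n := pow_le_pow_of_le_one (by norm_num) (by norm_num) n.le_succ
      _ < δ := hn

/-- Each cosine is replaced with error `1 / (n + 1)` on the ball of radius `n`. Starting from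
positive coefficients matters: their sum `g n 0` converges, so the errors do not accumulate. -/
theorem DenseInStationaryKernels.posOrthant_univ
    (H : DenseInStationaryKernels
      (spectralFamily (Set.Ioi 0) Set.univ (1 : EuclideanSpace ℝ (Fin d) → ℝ))) :
    DenseInStationaryKernels
      (spectralFamily Set.univ (posOrthant d) (1 : EuclideanSpace ℝ (Fin d) → ℝ)) := by
  intro k hk
  obtain ⟨g, hg, hlim⟩ := H k hk
  choose K α ω γ hK hα hω hγ hgeq using hg
  have key : ∀ n : ℕ, ∃ f ∈ posCosSpan d, ∀ τ, ‖τ‖ ≤ n →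
      |f τ - g n τ| ≤ g n 0 * (1 / ((n : ℝ) + 1)) := by
    intro n
    choose f hf hfa using fun j => exists_posCosSpan_approx (ω n j) n
      (by positivity : 0 < 1 / ((n : ℝ) + 1))
    refine ⟨∑ j, α n j • f j, Submodule.sum_mem _ fun j _ => Submodule.smul_mem _ _ (hf j),
      fun τ hτ => ?_⟩
    rw [hgeq, hgeq, Finset.sum_apply, ← Finset.sum_sub_distrib, Finset.sum_mul]
    refine (Finset.abs_sum_le_sum_abs _ _).trans (Finset.sum_le_sum fun j _ => ?_)
    have hαj : 0 < α n j := hα n j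
    simp only [Pi.one_apply, mul_one, inner_zero_right, mul_zero, Real.cos_zero, Pi.smul_apply,
      smul_eq_mul]
    rw [← mul_sub, abs_mul, abs_of_pos hαj]
    exact mul_le_mul_of_nonneg_left (hfa j τ hτ) hαj.le
  choose f hf hfa using key
  refine ⟨f, fun n => mem_spectralFamily_of_mem_posCosSpan (hf n), fun τ => ?_⟩
  have hbd : Tendsto (fun n => g n 0 * (1 / ((n : ℝ) + 1))) atTop (𝓝 0) := by
    simpa using (hlim 0).mul (tendsto_one_div_add_atTop_nhds_zero_nat (𝕜 := ℝ))
  refine tendsto_of_abs_sub_le (hlim τ) hbd ?_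
  filter_upwards [tendsto_natCast_atTop_atTop.eventually_ge_atTop ‖τ‖] with n hn
  exact hfa n τ hn

/-! ### Fejér sums on a lattice -/

/-- The angles `π (a - n) / n`, for `a < 2 n`, fill the interval `[-π, π)`. -/
def angle (n : ℕ) (a : Fin (2 * n)) : ℝ := Real.pi * ((a : ℝ) - n) / n

theorem abs_angle_le {n : ℕ} (hn : 0 < n) (a : Fin (2 * n)) : |angle n a| ≤ Real.pi := by
  have hn' : (0 : ℝ) < n := by exact_mod_cast hn
  have ha : (a : ℝ) ≤ 2 * n := by exact_mod_cast a.2.le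
  have ha0 : (0 : ℝ) ≤ a := Nat.cast_nonneg _
  rw [angle, abs_div, abs_mul, abs_of_pos Real.pi_pos, abs_of_pos hn', div_le_iff₀ hn']
  exact mul_le_mul_of_nonneg_left (abs_le.2 ⟨by linarith, by linarith⟩) Real.pi_pos.le

/-- Up to a constant factor this is the geometric sum of a `2 n`-th root of unity, which differs
from `1` when `0 < |u| < 2 n`. -/
theorem sum_exp_angle {n : ℕ} (hn : 0 < n) {u : ℤ} (hu : |u| < 2 * n) :
    ∑ a, Complex.exp (Complex.I * (angle n a * u : ℝ)) = if u = 0 then (2 * n : ℂ) else 0 := by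
  split_ifs with h
  · simp [h]
  have hn' : (n : ℂ) ≠ 0 := by exact_mod_cast hn.ne'
  set ζ : ℂ := Complex.exp (Complex.I * Real.pi * u / n) with hζ
  have h1 : ∀ a : Fin (2 * n), Complex.exp (Complex.I * (angle n a * u : ℝ)) =
      Complex.exp (-(Complex.I * Real.pi * u)) * ζ ^ (a : ℕ) := fun a => by
    rw [hζ, ← Complex.exp_nat_mul, ← Complex.exp_add, angle]
    congr 1
    push_cast
    field_simp
    ring
  have h2 : ζ ^ (2 * n) = 1 := by
    rw [hζ, ← Complex.exp_nat_mul, Complex.exp_eq_one_iff]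
    refine ⟨u, ?_⟩
    push_cast
    field_simp
  have h3 : ζ ≠ 1 := by
    rw [hζ, Ne, Complex.exp_eq_one_iff]
    rintro ⟨m, hm⟩
    have hpi : (Real.pi : ℂ) ≠ 0 := by exact_mod_cast Real.pi_ne_zero
    have h4 : (u : ℂ) = m * (2 * n) := by
      field_simp at hm
      linear_combination hm
    have h5 : u = m * (2 * n) := by exact_mod_cast h4
    refine h (Int.eq_zero_of_abs_lt_dvd (m := 2 * n) ⟨m, by rw [h5]; ring⟩ hu)
  simp only [h1]
  rw [← Finset.mul_sum, Fin.sum_univ_eq_sum_range (fun a => ζ ^ a), geom_sum_eq h3, h2]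
  simp

/-- Orthogonality of the lattice characters. -/
theorem sum_cos_angle {n : ℕ} (hn : 0 < n) {u : Fin d → ℤ} (hu : ∀ i, |u i| < 2 * n) :
    ∑ j : Fin d → Fin (2 * n), Real.cos (∑ i, angle n (j i) * u i) =
      if u = 0 then (2 * n : ℝ) ^ d else 0 := by
  have h1 : ∀ j : Fin d → Fin (2 * n), Real.cos (∑ i, angle n (j i) * u i) =
      (∏ i, Complex.exp (Complex.I * (angle n (j i) * u i : ℝ))).re := fun j => by
    rw [← Complex.exp_sum, ← Finset.mul_sum, ← Complex.ofReal_sum, mul_comm,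
      Complex.exp_ofReal_mul_I_re]
  simp only [h1]
  rw [← Complex.re_sum]
  have h2 := Finset.prod_univ_sum (fun _ : Fin d => (Finset.univ : Finset (Fin (2 * n))))
    (fun i a => Complex.exp (Complex.I * (angle n a * u i : ℝ)))
  rw [Fintype.piFinset_univ] at h2
  rw [← h2]
  simp only [fun i => sum_exp_angle hn (hu i)]
  split_ifs with h
  · simp only [h, Pi.zero_apply, if_true, Finset.prod_const, Finset.card_univ, Fintype.card_fin]
    exact_mod_cast Complex.ofReal_re ((2 * n : ℝ) ^ d)
  · obtain ⟨i, hi⟩ := Function.ne_iff.1 h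
    rw [Finset.prod_eq_zero (Finset.mem_univ i) (if_neg hi), Complex.zero_re]

/-- The point `z / N` of the lattice of mesh `1 / N`. -/
def latticePoint (N : ℕ) (z : Fin d → ℤ) : EuclideanSpace ℝ (Fin d) :=
  WithLp.toLp 2 fun i => (z i : ℝ) / N

theorem latticePoint_sub (N : ℕ) (x y : Fin d → ℤ) :
    latticePoint N (x - y) = latticePoint N x - latticePoint N y := by
  ext i
  simp [latticePoint, sub_div]

/-- The integer points of the box `[0, n)^d`. -/
def box (d n : ℕ) : Finset (Fin d → ℤ) := Fintype.piFinset fun _ => Finset.Ico 0 (n : ℤ)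

/-- The (nonnegative) discrete Fourier coefficients of the restriction of `k` to the lattice of mesh
`1 / N`, damped by the Fejér weights of a box of side `n`. -/
def fejerCoeff (k : EuclideanSpace ℝ (Fin d) → ℝ) (N n : ℕ) (j : Fin d → Fin (2 * n)) : ℝ :=
  (∑ x ∈ box d n, ∑ y ∈ box d n, k (latticePoint N (x - y)) *
    Real.cos (∑ i, angle n (j i) * (x - y) i)) / ((2 * n) ^ d * n ^ d)

/-- The trigonometric sum with coefficients `fejerCoeff`, in the scale where the lattice is
`ℤ^d`. -/
def fejerSum (k : EuclideanSpace ℝ (Fin d) → ℝ) (N n : ℕ) (u : Fin d → ℝ) : ℝ :=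
  ∑ j, fejerCoeff k N n j * Real.cos (∑ i, angle n (j i) * u i)

theorem IsPosSemidefFun.sum_nonneg {k : EuclideanSpace ℝ (Fin d) → ℝ} (hk : IsPosSemidefFun k)
    {ι : Type*} (s : Finset ι) (p : ι → EuclideanSpace ℝ (Fin d)) (c : ι → ℝ) :
    0 ≤ ∑ x ∈ s, ∑ y ∈ s, k (p x - p y) * (c x * c y) := by
  have h := (Matrix.PosSemidef.submatrix hk fun x : s => p x).dotProduct_mulVec_nonneg
    fun x : s => c x
  refine h.trans_eq (Eq.symm ?_)
  simp only [dotProduct, Matrix.mulVec, Matrix.submatrix_apply, Matrix.of_apply, Pi.star_apply,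
    star_trivial, Finset.mul_sum]
  rw [← Finset.sum_coe_sort s]
  refine Finset.sum_congr rfl fun x _ => ?_
  rw [← Finset.sum_coe_sort s]
  exact Finset.sum_congr rfl fun y _ => by ring

theorem IsPosSemidefFun.neg {k : EuclideanSpace ℝ (Fin d) → ℝ} (hk : IsPosSemidefFun k)
    (τ : EuclideanSpace ℝ (Fin d)) : k (-τ) = k τ := by
  have := hk.1.apply 0 τ
  simpa using this.symm

/-- Expanding `cos (A x - A y)` splits the double sum into two quadratic forms of `k`, with weights
`cos (A x)` and `sin (A x)`. -/
theorem fejerCoeff_nonneg {k : EuclideanSpace ℝ (Fin d) → ℝ} (hk : IsPosSemidefFun k) (N n : ℕ)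
    (j : Fin d → Fin (2 * n)) : 0 ≤ fejerCoeff k N n j := by
  refine div_nonneg ?_ (by positivity)
  let A : (Fin d → ℤ) → ℝ := fun x => ∑ i, angle n (j i) * x i
  have h1 := hk.sum_nonneg (box d n) (latticePoint N) fun x => Real.cos (A x)
  have h2 := hk.sum_nonneg (box d n) (latticePoint N) fun x => Real.sin (A x)
  refine (add_nonneg h1 h2).trans (le_of_eq ?_)
  rw [← Finset.sum_add_distrib]
  refine Finset.sum_congr rfl fun x _ => ?_
  rw [← Finset.sum_add_distrib]
  refine Finset.sum_congr rfl fun y _ => ?_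
  have hA : ∑ i, angle n (j i) * ((x - y) i : ℤ) = A x - A y := by
    simp only [A, ← Finset.sum_sub_distrib, Pi.sub_apply, Int.cast_sub, mul_sub]
  rw [hA, Real.cos_sub, latticePoint_sub]
  ring

/-- The number of pairs in `[0, n)` with difference `z` is `n - |z|`. -/
theorem sum_ite_sub_eq (n : ℕ) {z : ℤ} (hz : |z| ≤ n) :
    ∑ a ∈ Finset.Ico 0 (n : ℤ), ∑ b ∈ Finset.Ico 0 (n : ℤ), (if a - b = z then (1 : ℝ) else 0) =
      n - |(z : ℝ)| := by
  have h1 : ∀ a ∈ Finset.Ico 0 (n : ℤ),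
      ∑ b ∈ Finset.Ico 0 (n : ℤ), (if a - b = z then (1 : ℝ) else 0) =
      if a - z ∈ Finset.Ico 0 (n : ℤ) then 1 else 0 := fun a _ => by
    rw [← Finset.sum_ite_eq' (Finset.Ico 0 (n : ℤ)) (a - z) fun _ => (1 : ℝ)]
    exact Finset.sum_congr rfl fun b _ => by congr 1; exact propext ⟨by omega, by omega⟩
  rw [Finset.sum_congr rfl h1, ← Finset.sum_filter, Finset.sum_const, nsmul_one]
  have h2 : (Finset.Ico 0 (n : ℤ)).filter (fun a => a - z ∈ Finset.Ico 0 (n : ℤ)) =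
      Finset.Ico (max 0 z) (min n (n + z)) := by
    ext a
    simp only [Finset.mem_filter, Finset.mem_Ico]
    omega
  rw [h2, Int.card_Ico]
  have h3 : ((min (n : ℤ) (n + z) - max 0 z).toNat : ℤ) = n - |z| := by
    rcases abs_cases z with ⟨h, _⟩ | ⟨h, _⟩ <;> rw [h] at hz ⊢ <;> omega
  exact_mod_cast congrArg (Int.cast : ℤ → ℝ) h3

theorem sum_box_ite_sub_eq (n : ℕ) {z : Fin d → ℤ} (hz : ∀ i, |z i| ≤ n) :
    ∑ x ∈ box d n, ∑ y ∈ box d n, (if x - y = z then (1 : ℝ) else 0) =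
      ∏ i, (n - |(z i : ℝ)|) := by
  simp only [← fun i => sum_ite_sub_eq n (hz i)]
  rw [Finset.prod_univ_sum]
  refine Finset.sum_congr rfl fun x _ => ?_
  rw [Finset.prod_univ_sum]
  refine Finset.sum_congr rfl fun y _ => ?_
  rw [Finset.prod_ite_zero]
  simp [funext_iff]

theorem abs_sub_lt_of_mem_box {n : ℕ} {x y : Fin d → ℤ} (hx : x ∈ box d n) (hy : y ∈ box d n)
    (i : Fin d) : |x i - y i| < n := by
  have h1 := Finset.mem_Ico.1 (Fintype.mem_piFinset.1 hx i)
  have h2 := Finset.mem_Ico.1 (Fintype.mem_piFinset.1 hy i)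
  exact abs_lt.2 ⟨by omega, by omega⟩

/-- At lattice points the Fejér sum is the kernel damped by the Fejér weight. -/
theorem fejerSum_intCast {k : EuclideanSpace ℝ (Fin d) → ℝ} (hk : IsPosSemidefFun k) (N : ℕ)
    {n : ℕ} (hn : 0 < n) {z : Fin d → ℤ} (hz : ∀ i, |z i| ≤ n) :
    fejerSum k N n (fun i => z i) = (∏ i, (1 - |(z i : ℝ)| / n)) * k (latticePoint N z) := by
  have hn' : (n : ℝ) ≠ 0 := by exact_mod_cast hn.ne'
  -- Here `2 n` angles are used because the entries of `x - y ± z` can exceed `n` in size but stay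
  -- below `2 n`, which excludes aliasing.
  have horth : ∀ x ∈ box d n, ∀ y ∈ box d n,
      ∑ j : Fin d → Fin (2 * n), Real.cos (∑ i, angle n (j i) * (x - y) i) *
        Real.cos (∑ i, angle n (j i) * z i) =
      (2 * n : ℝ) ^ d / 2 * ((if x - y = z then 1 else 0) + if y - x = z then 1 else 0) := by
    intro x hx y hy
    have h1 : ∀ i, |(x - y - z) i| < 2 * n := fun i => by
      have e1 := abs_lt.1 (abs_sub_lt_of_mem_box hx hy i)
      have e2 := abs_le.1 (hz i)
      simp only [Pi.sub_apply]
      exact abs_lt.2 ⟨by omega, by omega⟩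
    have h2 : ∀ i, |(x - y + z) i| < 2 * n := fun i => by
      have e1 := abs_lt.1 (abs_sub_lt_of_mem_box hx hy i)
      have e2 := abs_le.1 (hz i)
      simp only [Pi.sub_apply, Pi.add_apply]
      exact abs_lt.2 ⟨by omega, by omega⟩
    have h3 : ∀ j : Fin d → Fin (2 * n), Real.cos (∑ i, angle n (j i) * (x - y) i) *
        Real.cos (∑ i, angle n (j i) * z i) =
        (Real.cos (∑ i, angle n (j i) * (x - y - z) i) +
          Real.cos (∑ i, angle n (j i) * (x - y + z) i)) / 2 := fun j => by
      have e1 : ∑ i, angle n (j i) * ((x - y - z) i : ℤ) =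
          ∑ i, angle n (j i) * ((x - y) i : ℤ) - ∑ i, angle n (j i) * z i := by
        rw [← Finset.sum_sub_distrib]
        exact Finset.sum_congr rfl fun i _ => by simp; ring
      have e2 : ∑ i, angle n (j i) * ((x - y + z) i : ℤ) =
          ∑ i, angle n (j i) * ((x - y) i : ℤ) + ∑ i, angle n (j i) * z i := by
        rw [← Finset.sum_add_distrib]
        exact Finset.sum_congr rfl fun i _ => by simp; ring
      rw [e1, e2, Real.cos_sub, Real.cos_add]
      ring
    simp only [h3]
    rw [← Finset.sum_div, Finset.sum_add_distrib, sum_cos_angle hn h1, sum_cos_angle hn h2]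
    have c1 : x - y - z = 0 ↔ x - y = z := sub_eq_zero
    have c2 : x - y + z = 0 ↔ y - x = z := by
      rw [add_eq_zero_iff_neg_eq, neg_sub]
    simp only [c1, c2]
    split_ifs <;> ring
  -- Evenness of `k` makes both product-to-sum terms equal, absorbing the factor `1 / 2`.
  have hswap : ∑ x ∈ box d n, ∑ y ∈ box d n,
      k (latticePoint N (x - y)) * (if y - x = z then 1 else 0) =
      ∑ x ∈ box d n, ∑ y ∈ box d n, k (latticePoint N (x - y)) * (if x - y = z then 1 else 0) := by
    rw [Finset.sum_comm]
    refine Finset.sum_congr rfl fun x _ => Finset.sum_congr rfl fun y _ => ?_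
    rw [← hk.neg (latticePoint N (y - x)), latticePoint_sub, latticePoint_sub, neg_sub]
  have hcount : ∑ x ∈ box d n, ∑ y ∈ box d n,
      k (latticePoint N (x - y)) * (if x - y = z then 1 else 0) =
      (∏ i, ((n : ℝ) - |(z i : ℝ)|)) * k (latticePoint N z) := by
    rw [← sum_box_ite_sub_eq n hz, Finset.sum_mul]
    refine Finset.sum_congr rfl fun x _ => ?_
    rw [Finset.sum_mul]
    refine Finset.sum_congr rfl fun y _ => ?_
    split_ifs with h
    · rw [h, mul_comm]
    · simp
  have hprod : ∏ i, (1 - |(z i : ℝ)| / n) = (∏ i, ((n : ℝ) - |(z i : ℝ)|)) / n ^ d := by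
    have : ∀ i, 1 - |(z i : ℝ)| / n = (n - |(z i : ℝ)|) / n := fun i => by field_simp
    simp only [this]
    rw [Finset.prod_div_distrib]
    simp
  calc fejerSum k N n (fun i => z i)
      = (∑ x ∈ box d n, ∑ y ∈ box d n, k (latticePoint N (x - y)) *
          ∑ j : Fin d → Fin (2 * n), Real.cos (∑ i, angle n (j i) * (x - y) i) *
            Real.cos (∑ i, angle n (j i) * z i)) / ((2 * n) ^ d * n ^ d) := by
        simp only [fejerSum, fejerCoeff, div_mul_eq_mul_div, ← Finset.sum_div, Finset.sum_mul,
          Finset.mul_sum]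
        congr 1
        rw [Finset.sum_comm]
        refine Finset.sum_congr rfl fun x _ => ?_
        rw [Finset.sum_comm]
        refine Finset.sum_congr rfl fun y _ => Finset.sum_congr rfl fun j _ => by ring
    _ = ((2 * n : ℝ) ^ d / 2 * (∑ x ∈ box d n, ∑ y ∈ box d n,
          k (latticePoint N (x - y)) * (if x - y = z then 1 else 0) +
          ∑ x ∈ box d n, ∑ y ∈ box d n,
          k (latticePoint N (x - y)) * (if y - x = z then 1 else 0))) / ((2 * n) ^ d * n ^ d) := by
        congr 1
        rw [← Finset.sum_add_distrib, Finset.mul_sum]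
        refine Finset.sum_congr rfl fun x hx => ?_
        rw [← Finset.sum_add_distrib, Finset.mul_sum]
        refine Finset.sum_congr rfl fun y hy => ?_
        rw [horth x hx y hy]
        ring
    _ = _ := by
        rw [hswap, hcount, hprod]
        field_simp
        ring

/-! ### Equicontinuity of the Fejér sums -/

/-- `|sin|` is even and increasing on `[0, π / 2]`. This is why the angles are taken in `[-π, π)`: a
fractional step moves a cosine no more than the bound for a unit step. -/
theorem abs_sin_mul_le {θ t : ℝ} (hθ : |θ| ≤ Real.pi) (ht : |t| ≤ 1) :
    |Real.sin (θ * t / 2)| ≤ |Real.sin (θ / 2)| := by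
  have key : ∀ x : ℝ, |x| ≤ Real.pi / 2 → |Real.sin x| = Real.sin |x| := fun x hx => by
    rcases abs_cases x with ⟨h, h'⟩ | ⟨h, h'⟩ <;> rw [h] at hx ⊢
    · exact abs_of_nonneg (Real.sin_nonneg_of_nonneg_of_le_pi h' (by linarith [Real.pi_pos]))
    · rw [Real.sin_neg]
      exact abs_of_nonpos (Real.sin_nonpos_of_nonpos_of_neg_pi_le h'.le (by linarith [Real.pi_pos]))
  have h1 : |θ * t / 2| ≤ |θ / 2| := by
    rw [abs_div, abs_div, abs_mul]
    gcongr
    exact mul_le_of_le_one_right (abs_nonneg _) ht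
  have h2 : |θ / 2| ≤ Real.pi / 2 := by
    rw [abs_div, abs_two]
    gcongr
  rw [key _ h2, key _ (h1.trans h2)]
  exact Real.sin_le_sin_of_le_of_le_pi_div_two (by linarith [Real.pi_pos, abs_nonneg (θ * t / 2)])
    h2 h1

theorem abs_sin_sum_le {ι : Type*} (s : Finset ι) (f : ι → ℝ) :
    |Real.sin (∑ i ∈ s, f i)| ≤ ∑ i ∈ s, |Real.sin (f i)| := by
  classical
  induction s using Finset.induction with
  | empty => simp
  | insert a s ha ih =>
    rw [Finset.sum_insert ha, Finset.sum_insert ha, Real.sin_add]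
    refine (abs_add_le _ _).trans (add_le_add ?_ (le_trans ?_ ih)) <;> rw [abs_mul]
    · exact mul_le_of_le_one_right (abs_nonneg _) (Real.abs_cos_le_one _)
    · exact mul_le_of_le_one_left (abs_nonneg _) (Real.abs_cos_le_one _)

/-- Each term changes by at most its coefficient times `∑ i, 2 |sin (angle / 2)|`. Cauchy–Schwarz
with the coefficients as weights, together with `(2 sin (θ / 2)) ^ 2 = 2 (1 - cos θ)`, turns this
into values of the sum at `0` and at the unit vectors. -/
theorem abs_fejerSum_sub_le {k : EuclideanSpace ℝ (Fin d) → ℝ} (hk : IsPosSemidefFun k) (N : ℕ)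
    {n : ℕ} (hn : 0 < n) {u v : Fin d → ℝ} (huv : ∀ i, |u i - v i| ≤ 1) :
    |fejerSum k N n u - fejerSum k N n v| ≤ ∑ i, √(2 * fejerSum k N n 0 *
      (fejerSum k N n 0 - fejerSum k N n (Pi.single i 1))) := by
  have hα := fejerCoeff_nonneg hk N n
  have h1 : |fejerSum k N n u - fejerSum k N n v| ≤
      ∑ j, fejerCoeff k N n j * ∑ i, 2 * |Real.sin (angle n (j i) / 2)| := by
    simp only [fejerSum]
    rw [← Finset.sum_sub_distrib]
    refine (Finset.abs_sum_le_sum_abs _ _).trans (Finset.sum_le_sum fun j _ => ?_)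
    rw [← mul_sub, abs_mul, abs_of_nonneg (hα j)]
    refine mul_le_mul_of_nonneg_left ((abs_cos_sub_cos_le _ _).trans ?_) (hα j)
    rw [← Finset.sum_sub_distrib, Finset.sum_div, ← Finset.mul_sum]
    refine mul_le_mul_of_nonneg_left ((abs_sin_sum_le _ _).trans
      (Finset.sum_le_sum fun i _ => ?_)) zero_le_two
    rw [← mul_sub]
    exact abs_sin_mul_le (abs_angle_le hn _) (huv i)
  refine h1.trans ?_
  simp only [Finset.mul_sum]
  rw [Finset.sum_comm]
  refine Finset.sum_le_sum fun i _ => Real.le_sqrt_of_sq_le ?_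
  have h2 := Finset.sum_mul_sq_le_sq_mul_sq Finset.univ (fun j => √(fejerCoeff k N n j))
    fun j => √(fejerCoeff k N n j) * (2 * |Real.sin (angle n (j i) / 2)|)
  have e0 : fejerSum k N n 0 = ∑ j, fejerCoeff k N n j := by simp [fejerSum]
  have e1 : fejerSum k N n 0 - fejerSum k N n (Pi.single i 1) =
      ∑ j, fejerCoeff k N n j * (1 - Real.cos (angle n (j i))) := by
    rw [e0, fejerSum, ← Finset.sum_sub_distrib]
    refine Finset.sum_congr rfl fun j _ => ?_
    simp [Pi.single_apply]
    ring
  have e2 : ∀ j : Fin d → Fin (2 * n), (2 * |Real.sin (angle n (j i) / 2)|) ^ 2 =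
      2 * (1 - Real.cos (angle n (j i))) := fun j => by
    rw [mul_pow, sq_abs, Real.sin_sq_eq_half_sub, mul_div_cancel₀ _ (two_ne_zero' ℝ)]
    ring
  have e3 : ∀ j : Fin d → Fin (2 * n), √(fejerCoeff k N n j) * (√(fejerCoeff k N n j) *
      (2 * |Real.sin (angle n (j i) / 2)|)) =
      fejerCoeff k N n j * (2 * |Real.sin (angle n (j i) / 2)|) := fun j => by
    rw [← mul_assoc, Real.mul_self_sqrt (hα j)]
  have e4 : ∀ j : Fin d → Fin (2 * n), (√(fejerCoeff k N n j) *
      (2 * |Real.sin (angle n (j i) / 2)|)) ^ 2 =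
      2 * (fejerCoeff k N n j * (1 - Real.cos (angle n (j i)))) := fun j => by
    rw [mul_pow, e2, Real.sq_sqrt (hα j)]
    ring
  simp only [e3, e4, Real.sq_sqrt (hα _)] at h2
  refine h2.trans (le_of_eq ?_)
  rw [e1, e0, ← Finset.mul_sum]
  ring

/-! ### Convergence -/

/-- With `N = m + 1` and box side `N ^ 2`, the physical side of the box is `N → ∞`, so the Fejér
weights at a convergent sequence of lattice points tend to `1`. -/
theorem tendsto_fejerSum_intCast {k : EuclideanSpace ℝ (Fin d) → ℝ} (hk : IsStationaryKernel k)
    {z : ℕ → Fin d → ℤ} {τ : EuclideanSpace ℝ (Fin d)}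
    (hz : Tendsto (fun m => latticePoint (m + 1) (z m)) atTop (𝓝 τ)) :
    Tendsto (fun m => fejerSum k (m + 1) ((m + 1) ^ 2) fun i => z m i) atTop (𝓝 (k τ)) := by
  have hc : ∀ i, Tendsto (fun m => |(z m i : ℝ)| / ((m + 1) ^ 2 : ℕ)) atTop (𝓝 0) := fun i => by
    have h1 : Tendsto (fun m => latticePoint (m + 1) (z m) i) atTop (𝓝 (τ i)) :=
      ((PiLp.continuous_apply 2 _ i).tendsto τ).comp hz
    have h2 := h1.abs.mul (tendsto_one_div_add_atTop_nhds_zero_nat (𝕜 := ℝ))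
    rw [mul_zero] at h2
    refine h2.congr fun m => ?_
    have : (0 : ℝ) < m + 1 := by positivity
    simp only [latticePoint]
    push_cast
    rw [abs_div, abs_of_pos this]
    field_simp
  have hp : Tendsto (fun m => ∏ i, (1 - |(z m i : ℝ)| / ((m + 1) ^ 2 : ℕ))) atTop (𝓝 1) := by
    simpa using tendsto_finsetProd Finset.univ fun i _ => (hc i).const_sub 1
  have hlim := hp.mul ((hk.continuous.tendsto τ).comp hz)
  rw [one_mul] at hlim
  refine hlim.congr' ?_
  have hev : ∀ᶠ m in atTop, ∀ i, |(z m i : ℝ)| / ((m + 1) ^ 2 : ℕ) < 1 :=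
    eventually_all.2 fun i => (hc i).eventually_lt_const one_pos
  filter_upwards [hev] with m hm
  refine (fejerSum_intCast hk.posSemidef (m + 1) (by positivity) fun i => ?_).symm
  have h1 := (div_lt_one (by positivity)).1 (hm i)
  exact_mod_cast h1.le

/-- Rounding `τ` down to the lattice reduces to the previous case. The error vanishes because the
lattice unit steps shrink to `0`, so the sums at `0` and at the unit vectors share the limit `k 0`.
-/
theorem tendsto_fejerSum {k : EuclideanSpace ℝ (Fin d) → ℝ} (hk : IsStationaryKernel k)
    (τ : EuclideanSpace ℝ (Fin d)) :
    Tendsto (fun m : ℕ => fejerSum k (m + 1) ((m + 1) ^ 2) fun i => (m + 1) * τ i) atTop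
      (𝓝 (k τ)) := by
  have h0 : Tendsto (fun m => fejerSum k (m + 1) ((m + 1) ^ 2) 0) atTop (𝓝 (k 0)) := by
    have := tendsto_fejerSum_intCast hk (z := fun _ => 0) (τ := 0) (by
      have : ∀ m : ℕ, latticePoint (d := d) (m + 1) 0 = 0 := fun m => by ext i; simp [latticePoint]
      simp [this])
    refine this.congr fun m => ?_
    congr 1
    ext i
    simp
  have h1 : ∀ i, Tendsto (fun m => fejerSum k (m + 1) ((m + 1) ^ 2) (Pi.single i 1)) atTop
      (𝓝 (k 0)) := fun i => by
    have := tendsto_fejerSum_intCast hk (z := fun _ => Pi.single i 1) (τ := 0) (by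
      have e : ∀ m : ℕ, latticePoint (d := d) (m + 1) (Pi.single i 1) =
          (1 / ((m : ℝ) + 1)) • latticePoint 1 (Pi.single i 1) := fun m => by
        ext l; simp [latticePoint, div_eq_inv_mul]
      refine Tendsto.congr (fun m => (e m).symm) ?_
      simpa using (tendsto_one_div_add_atTop_nhds_zero_nat (𝕜 := ℝ)).smul_const
        (latticePoint (d := d) 1 (Pi.single i 1)))
    refine this.congr fun m => ?_
    congr 1
    ext l
    rcases eq_or_ne l i with rfl | h <;> simp [*]
  have hmain := tendsto_fejerSum_intCast hk (z := fun m i => ⌊((m : ℝ) + 1) * τ i⌋) (τ := τ) (by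
    have hco : Tendsto (fun m : ℕ => fun i => (⌊((m : ℝ) + 1) * τ i⌋ : ℝ) / ((m + 1 : ℕ) : ℝ)) atTop
        (𝓝 fun i => τ i) := by
      refine tendsto_pi_nhds.2 fun i => ?_
      refine tendsto_of_abs_sub_le tendsto_const_nhds
        (tendsto_one_div_add_atTop_nhds_zero_nat (𝕜 := ℝ)) (Eventually.of_forall fun m => ?_)
      have hm : (0 : ℝ) < m + 1 := by positivity
      have a1 := Int.floor_le (((m : ℝ) + 1) * τ i)
      have a2 := Int.lt_floor_add_one (((m : ℝ) + 1) * τ i)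
      push_cast
      rw [div_sub' hm.ne', abs_div, abs_of_pos hm]
      gcongr
      exact abs_le.2 ⟨by linarith, by linarith⟩
    exact ((PiLp.continuous_toLp 2 _).tendsto _).comp hco)
  have herr : Tendsto (fun m => ∑ i, √(2 * fejerSum k (m + 1) ((m + 1) ^ 2) 0 *
      (fejerSum k (m + 1) ((m + 1) ^ 2) 0 -
        fejerSum k (m + 1) ((m + 1) ^ 2) (Pi.single i 1)))) atTop (𝓝 0) := by
    have := tendsto_finsetSum Finset.univ fun i _ =>
      ((h0.const_mul 2).mul (h0.sub (h1 i))).sqrt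
    simpa using this
  refine tendsto_of_abs_sub_le hmain herr (Eventually.of_forall fun m => ?_)
  refine abs_fejerSum_sub_le hk.posSemidef (m + 1) (by positivity) fun i => ?_
  have a1 := Int.floor_le (((m : ℝ) + 1) * τ i)
  have a2 := Int.lt_floor_add_one (((m : ℝ) + 1) * τ i)
  exact abs_le.2 ⟨by linarith, by linarith⟩

/-- Positive combinations of cosines are dense in the stationary kernels. -/
theorem denseInStationaryKernels_cosSum (d : ℕ) :
    DenseInStationaryKernels
      (spectralFamily (Set.Ioi 0) Set.univ (1 : EuclideanSpace ℝ (Fin d) → ℝ)) := by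
  intro k hk
  let J : ℕ → Type := fun m => Fin d → Fin (2 * (m + 1) ^ 2)
  -- Added to each coefficient to make it strictly positive, at a total cost of `1 / (m + 1)`.
  let c : ℕ → ℝ := fun m => 1 / ((m : ℝ) + 1) / Fintype.card (J m)
  let ω : ∀ m, J m → EuclideanSpace ℝ (Fin d) := fun m j =>
    WithLp.toLp 2 fun i => ((m : ℝ) + 1) * angle ((m + 1) ^ 2) (j i) / (2 * Real.pi)
  have hJ : ∀ m, Nonempty (J m) := fun m => ⟨fun _ => ⟨0, by positivity⟩⟩
  have hcard : ∀ m, (0 : ℝ) < Fintype.card (J m) := fun m => by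
    have := hJ m
    exact_mod_cast Fintype.card_pos
  have hc : ∀ m, 0 < c m := fun m => div_pos (by positivity) (hcard m)
  refine ⟨fun m τ => ∑ j : J m, (fejerCoeff k (m + 1) ((m + 1) ^ 2) j + c m) *
    Real.cos (2 * Real.pi * inner ℝ (ω m j) τ), fun m => ?_, fun τ => ?_⟩
  · have := hJ m
    exact cosSum_mem_spectralFamily_one _ _
      (fun j => add_pos_of_nonneg_of_pos (fejerCoeff_nonneg hk.posSemidef _ _ j) (hc m))
      fun _ => trivial
  · refine tendsto_of_abs_sub_le (tendsto_fejerSum hk τ)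
      (tendsto_one_div_add_atTop_nhds_zero_nat (𝕜 := ℝ)) (Eventually.of_forall fun m => ?_)
    have hphase : ∀ j : J m, 2 * Real.pi * inner ℝ (ω m j) τ =
        ∑ i, angle ((m + 1) ^ 2) (j i) * ((m + 1) * τ i) := fun j => by
      rw [PiLp.inner_apply, Finset.mul_sum]
      refine Finset.sum_congr rfl fun i _ => ?_
      simp only [ω, RCLike.inner_apply, conj_trivial]
      field_simp
    simp only [fejerSum, hphase]
    rw [← Finset.sum_sub_distrib]
    refine (Finset.abs_sum_le_sum_abs _ _).trans ?_
    calc _ ≤ ∑ j : J m, c m := Finset.sum_le_sum fun j _ => by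
          rw [add_mul, add_sub_cancel_left, abs_mul, abs_of_pos (hc m)]
          exact mul_le_of_le_one_right (hc m).le (Real.abs_cos_le_one _)
      _ = 1 / ((m : ℝ) + 1) := by
          rw [Finset.sum_const, Finset.card_univ, nsmul_eq_mul]
          exact mul_div_cancel₀ _ (hcard m).ne'

/-! ### The Matérn kernel at the origin -/

open MeasureTheory Set in
-- The substitution `u = (x / 2) * exp t` turns `x * cosh t` into `u + x ^ 2 / (4 u)`, exposing a
-- truncated Gamma integral. The indicator keeps the domain independent of `x`, ready for dominated
-- convergence.
theorem rpow_mul_integral_exp_cosh {x ν : ℝ} (hx : 0 < x) (hν : 0 < ν) :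
    IntegrableOn (fun t => Real.exp (-x * Real.cosh t) * Real.exp (ν * t)) (Ioi 0) ∧
    x ^ ν * ∫ t in Ioi (0 : ℝ), Real.exp (-x * Real.cosh t) * Real.exp (ν * t) =
      2 ^ ν * ∫ u in Ioi (0 : ℝ), (Ioi (x / 2)).indicator
        (fun u => Real.exp (-x ^ 2 / (4 * u)) * (Real.exp (-u) * u ^ (ν - 1))) u := by
  let F : ℝ → ℝ := fun u => Real.exp (-x ^ 2 / (4 * u)) * (Real.exp (-u) * u ^ (ν - 1))
  let φ : ℝ → ℝ := fun t => x / 2 * Real.exp t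
  have hφ : ∀ t ∈ Ioi (0 : ℝ), HasDerivWithinAt φ (φ t) (Ioi 0) t := fun t _ =>
    ((Real.hasDerivAt_exp t).const_mul (x / 2)).hasDerivWithinAt
  have hinj : InjOn φ (Ioi 0) := fun a _ b _ hab =>
    Real.exp_injective (mul_left_cancel₀ (by positivity : x / 2 ≠ 0) hab)
  have himg : φ '' Ioi 0 = Ioi (x / 2) := by
    ext u
    constructor
    · rintro ⟨t, ht, rfl⟩
      have := Real.one_lt_exp_iff.2 ht
      simp only [φ, mem_Ioi]
      nlinarith
    · intro hu
      have hu' : x / 2 < u := hu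
      have hu1 : 1 < u / (x / 2) := (one_lt_div (by positivity)).2 hu'
      refine ⟨Real.log (u / (x / 2)), Real.log_pos hu1, ?_⟩
      simp only [φ]
      rw [Real.exp_log (by linarith)]
      field_simp
  have hF : IntegrableOn F (Ioi 0) := by
    refine (Real.GammaIntegral_convergent hν).mono' (by fun_prop) ?_
    refine (ae_restrict_iff' measurableSet_Ioi).2 (Eventually.of_forall fun u hu => ?_)
    have hu' : 0 < u := hu
    have h0 : 0 ≤ Real.exp (-u) * u ^ (ν - 1) := by positivity
    rw [Real.norm_of_nonneg (by positivity)]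
    refine mul_le_of_le_one_left h0 (Real.exp_le_one_iff.2 ?_)
    rw [neg_div]
    exact neg_nonpos.2 (by positivity)
  have hF' : IntegrableOn F (φ '' Ioi 0) := by
    rw [himg]
    exact hF.mono_set (Ioi_subset_Ioi (by positivity))
  have hval : ∀ t, |φ t| • F (φ t) =
      (x / 2) ^ ν * (Real.exp (-x * Real.cosh t) * Real.exp (ν * t)) := fun t => by
    have hp : 0 < φ t := by positivity
    have e1 : -x ^ 2 / (4 * φ t) + -φ t = -x * Real.cosh t := by
      simp only [φ]
      rw [Real.cosh_eq, Real.exp_neg]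
      field_simp
      ring
    have e2 : φ t * φ t ^ (ν - 1) = (x / 2) ^ ν * Real.exp (ν * t) := by
      rw [← Real.rpow_one_add' hp.le (by simpa using hν.ne'), add_sub_cancel]
      simp only [φ]
      rw [Real.mul_rpow (by positivity) (Real.exp_pos t).le, ← Real.exp_mul, mul_comm t]
    rw [abs_of_pos hp, smul_eq_mul, ← e1, Real.exp_add]
    simp only [F]
    linear_combination Real.exp (-x ^ 2 / (4 * φ t)) * Real.exp (-φ t) * e2
  have hpow : (x / 2) ^ ν ≠ 0 := by positivity
  have hint := (integrableOn_image_iff_integrableOn_abs_deriv_smul measurableSet_Ioi hφ hinj F).1 hF'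
  have heq := integral_image_eq_integral_abs_deriv_smul measurableSet_Ioi hφ hinj F
  simp only [hval] at hint heq
  refine ⟨(integrable_const_mul_iff (Ne.isUnit hpow) _).1 hint, ?_⟩
  rw [setIntegral_indicator measurableSet_Ioi,
    inter_eq_right.2 (Ioi_subset_Ioi (by positivity : 0 ≤ x / 2)), ← himg, heq,
    integral_const_mul, Real.div_rpow hx.le zero_le_two]
  field_simp

open MeasureTheory Set in
-- Split `cosh (ν t)` into exponentials. The growing half tends to the Gamma integral by dominated
-- convergence; the decaying half is bounded uniformly in `x > 0`, so the factor `x ^ ν` kills it.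
theorem tendsto_rpow_mul_besselK {ν : ℝ} (hν : 0 < ν) :
    Tendsto (fun x => x ^ ν * besselK ν x) (𝓝[>] 0) (𝓝 (Real.Gamma ν * 2 ^ (ν - 1))) := by
  let J : ℝ → ℝ := fun x => ∫ u in Ioi (0 : ℝ), (Ioi (x / 2)).indicator
        (fun u => Real.exp (-x ^ 2 / (4 * u)) * (Real.exp (-u) * u ^ (ν - 1))) u
  let B : ℝ → ℝ := fun x => ∫ t in Ioi (0 : ℝ), Real.exp (-x * Real.cosh t) * Real.exp (-ν * t)
  have hBint : ∀ x > 0, IntegrableOn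
      (fun t => Real.exp (-x * Real.cosh t) * Real.exp (-ν * t)) (Ioi 0) := fun x hx => by
    refine (exp_neg_integrableOn_Ioi 0 hν).mono' (by fun_prop) (Eventually.of_forall fun t => ?_)
    rw [Real.norm_of_nonneg (by positivity)]
    refine mul_le_of_le_one_left (Real.exp_pos _).le (Real.exp_le_one_iff.2 ?_)
    have := Real.cosh_pos t
    nlinarith
  have hJ : Tendsto J (𝓝[>] 0) (𝓝 (Real.Gamma ν)) := by
    rw [Real.Gamma_eq_integral hν]
    refine tendsto_integral_filter_of_dominated_convergence
      (fun u => Real.exp (-u) * u ^ (ν - 1)) ?_ ?_ (Real.GammaIntegral_convergent hν) ?_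
    · refine Eventually.of_forall fun x => ?_
      have : Measurable fun u : ℝ =>
        Real.exp (-x ^ 2 / (4 * u)) * (Real.exp (-u) * u ^ (ν - 1)) := by fun_prop
      exact (this.indicator measurableSet_Ioi).aestronglyMeasurable
    · refine Eventually.of_forall fun x => ?_
      refine (ae_restrict_iff' measurableSet_Ioi).2 (Eventually.of_forall fun u hu => ?_)
      have hu' : 0 < u := hu
      have h0 : 0 ≤ Real.exp (-u) * u ^ (ν - 1) := by positivity
      refine (norm_indicator_le_norm_self _ _).trans ?_
      rw [Real.norm_of_nonneg (by positivity)]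
      refine mul_le_of_le_one_left h0 (Real.exp_le_one_iff.2 ?_)
      rw [neg_div]
      exact neg_nonpos.2 (by positivity)
    · refine (ae_restrict_iff' measurableSet_Ioi).2 (Eventually.of_forall fun u hu => ?_)
      have hu' : 0 < u := hu
      have h1 : Tendsto (fun x : ℝ => Real.exp (-x ^ 2 / (4 * u)) * (Real.exp (-u) * u ^ (ν - 1)))
          (𝓝[>] 0) (𝓝 (Real.exp (-u) * u ^ (ν - 1))) := by
        have : Continuous fun x : ℝ =>
          Real.exp (-x ^ 2 / (4 * u)) * (Real.exp (-u) * u ^ (ν - 1)) := by fun_prop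
        simpa using (this.tendsto 0).mono_left nhdsWithin_le_nhds
      refine h1.congr' ?_
      have : Iio (2 * u) ∈ 𝓝[>] (0 : ℝ) := mem_nhdsWithin_of_mem_nhds (Iio_mem_nhds (by positivity))
      filter_upwards [this] with x hx
      have hx' : x < 2 * u := hx
      rw [indicator_of_mem]
      rw [mem_Ioi]
      linarith
  have hB : Tendsto (fun x => x ^ ν * B x) (𝓝[>] 0) (𝓝 0) := by
    have hz : Tendsto (fun x : ℝ => x ^ ν * ∫ t in Ioi (0 : ℝ), Real.exp (-ν * t))
        (𝓝[>] 0) (𝓝 0) := by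
      have := ((Real.continuousAt_rpow_const 0 ν (Or.inr hν.le)).tendsto.mono_left
        nhdsWithin_le_nhds : Tendsto (fun x : ℝ => x ^ ν) (𝓝[>] 0) _).mul_const
          (∫ t in Ioi (0 : ℝ), Real.exp (-ν * t))
      simpa [Real.zero_rpow hν.ne'] using this
    refine squeeze_zero' ?_ ?_ hz
    · filter_upwards [self_mem_nhdsWithin] with x hx
      exact mul_nonneg (Real.rpow_nonneg (le_of_lt hx) _) (integral_nonneg fun t => by positivity)
    · filter_upwards [self_mem_nhdsWithin] with x hx
      have hx' : 0 < x := hx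
      refine mul_le_mul_of_nonneg_left (integral_mono (hBint x hx)
        (exp_neg_integrableOn_Ioi 0 hν) fun t => ?_) (by positivity)
      refine mul_le_of_le_one_left (Real.exp_pos _).le (Real.exp_le_one_iff.2 ?_)
      have := Real.cosh_pos t
      nlinarith
  have key : Tendsto (fun x => 2 ^ (ν - 1) * J x + x ^ ν * B x / 2) (𝓝[>] 0)
      (𝓝 (Real.Gamma ν * 2 ^ (ν - 1))) := by
    have := (hJ.const_mul (2 ^ (ν - 1))).add (hB.div_const 2)
    rwa [zero_div, add_zero, mul_comm] at this
  refine key.congr' ?_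
  filter_upwards [self_mem_nhdsWithin] with x hx
  obtain ⟨hAint, hA⟩ := rpow_mul_integral_exp_cosh (x := x) hx hν
  have hK : besselK ν x = ((∫ t in Ioi (0 : ℝ), Real.exp (-x * Real.cosh t) * Real.exp (ν * t)) +
      B x) / 2 := by
    rw [← integral_add hAint (hBint x hx), ← integral_div, besselK]
    congr 1
    ext t
    rw [Real.cosh_eq (ν * t), neg_mul ν]
    ring
  have h2 : (2 : ℝ) ^ (ν - 1) = 2 ^ ν / 2 := Real.rpow_sub_one two_ne_zero ν
  change _ = 2 ^ ν * J x at hA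
  rw [hK, h2]
  linear_combination -hA / 2

theorem maternKernel_continuousAt_zero (d : ℕ) {ν : ℝ} (hν : 0 < ν) :
    ContinuousAt (maternKernel d ν) 0 := by
  rw [continuousAt_iff_punctured_nhds]
  have h0 : maternKernel d ν 0 = 1 := if_pos rfl
  rw [h0]
  have hG : Real.Gamma ν * 2 ^ (ν - 1) ≠ 0 :=
    mul_ne_zero (Real.Gamma_pos_of_pos hν).ne' (by positivity)
  have hs : 0 < √(2 * ν) := Real.sqrt_pos.2 (by positivity)
  have h1 : Tendsto (fun τ : EuclideanSpace ℝ (Fin d) => ‖τ‖ * √(2 * ν)) (𝓝[≠] 0) (𝓝[>] 0) := by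
    refine tendsto_nhdsWithin_iff.2 ⟨?_, ?_⟩
    · have : Continuous fun τ : EuclideanSpace ℝ (Fin d) => ‖τ‖ * √(2 * ν) := by fun_prop
      simpa using (this.tendsto 0).mono_left nhdsWithin_le_nhds
    · filter_upwards [self_mem_nhdsWithin] with τ hτ
      exact mul_pos (norm_pos_iff.2 hτ) hs
  have h2 := ((tendsto_rpow_mul_besselK hν).comp h1).const_mul (1 / (Real.Gamma ν * 2 ^ (ν - 1)))
  rw [one_div_mul_cancel hG] at h2
  refine h2.congr' ?_
  filter_upwards [self_mem_nhdsWithin] with τ hτ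
  rw [maternKernel, if_neg (show ¬τ = 0 from hτ), Function.comp, mul_assoc]

end SpectralKernels

end

/-! ### The density theorem -/

theorem theorem2 (d : ℕ) :
    (∀ h : EuclideanSpace ℝ (Fin d) → ℝ,
      SpectralKernels.IsPosSemidefFun h → Continuous h →
      MeasureTheory.Integrable h MeasureTheory.volume → (∀ τ, 0 < h τ) →
      SpectralKernels.DenseInStationaryKernels
        (SpectralKernels.spectralFamily Set.univ (SpectralKernels.posOrthant d) h)) ∧
    (∀ h : EuclideanSpace ℝ (Fin d) → ℝ,
      (h = SpectralKernels.gaussianKernel d ∨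
        ∃ ν : ℝ, 0 < ν ∧ h = SpectralKernels.maternKernel d ν) →
      -- real coefficients, frequencies in the positive orthant
      SpectralKernels.DenseInStationaryKernels
        (SpectralKernels.spectralFamily Set.univ (SpectralKernels.posOrthant d) h) ∧
      -- positive coefficients, frequencies of arbitrary signs
      SpectralKernels.DenseInStationaryKernels
        (SpectralKernels.spectralFamily (Set.Ioi 0) Set.univ h) ∧
      -- positive coefficients, positive frequencies, on the line
      (d = 1 → SpectralKernels.DenseInStationaryKernels
        (SpectralKernels.spectralFamily (Set.Ioi 0) (SpectralKernels.posOrthant d) h))) := by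
  have hdense := SpectralKernels.denseInStationaryKernels_cosSum d
  have hpos : ∀ c : ℝ, 0 < c → ∀ a ∈ Set.Ioi (0 : ℝ), a / c ∈ Set.Ioi (0 : ℝ) :=
    fun c hc a ha => div_pos ha hc
  refine ⟨fun h _ hcont _ hh => hdense.posOrthant_univ.of_one (fun _ _ _ _ => trivial)
    hcont.continuousAt (hh 0), fun h hh => ?_⟩
  obtain ⟨hcont, h0⟩ : ContinuousAt h 0 ∧ 0 < h 0 := by
    rcases hh with rfl | ⟨ν, hν, rfl⟩
    · have : Continuous (SpectralKernels.gaussianKernel d) := by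
        unfold SpectralKernels.gaussianKernel
        fun_prop
      exact ⟨this.continuousAt, Real.exp_pos _⟩
    · refine ⟨SpectralKernels.maternKernel_continuousAt_zero d hν, ?_⟩
      rw [SpectralKernels.maternKernel, if_pos rfl]
      exact one_pos
  refine ⟨hdense.posOrthant_univ.of_one (fun _ _ _ _ => trivial) hcont h0,
    hdense.of_one hpos hcont h0, ?_⟩
  rintro rfl
  exact hdense.posOrthant_one.of_one hpos hcont h0
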